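/- Let $1<p<\infty$ and $0<q<p$. For locally finite Borel measures $\sigma,\omega$ on $\mathbb{R}^d$ and a family $\lambda=\{\lambda_Q\}$ of non-negative reals indexed by the collection of all (half-open) dyadic cubes $Q\subset\mathbb{R}^d$, let $$M_\lambda(f\sigma):=\sup_Q \lambda_Q\Big(\frac{1}{\sigma(Q)}\int_Q|f|\,\mathrm{d}\sigma\Big)1_Q ,$$ let $\|M_\lambda(\cdot\,\sigma)\|_{L^p(\sigma)\to L^q(\omega)}\in[0,\infty]$ be the least constant $C$ such that $\|M_\lambda(f\sigma)\|_{L^q(\omega)}\le C\|f\|_{L^p(\sigma)}$ for all $f\in L^p(\sigma)$, where $\|g\|_{L^r(\mu)}:=(\int|g|^r\,\mathrm{d}\mu)^{1/r}$, and, for $\gamma\in\mathbb{R}\setminus\{0\}$, let $$\Lambda^{\sup}_{\gamma,Q}:=\Big(\frac{1}{\omega(Q)}\int_Q\big(\sup_{R\subseteq Q}\lambda_R1_R\big)^\gamma\,\mathrm{d}\omega\Big)^{1/\gamma},$$ the supremum being over dyadic cubes $R\subseteq Q$. All quantities take values in $[0,\infty]$, with $\frac00=0\cdot\infty=0$ and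 $\frac{a}{0}=\infty$ for $a>0$; for $\gamma<0$, $0^{\gamma}=\infty$ and $\infty^{\gamma}=0$. (i) (Sufficient condition) There is a finite constant $C$ depending only on $p,q$ such that, for all $d$, $\sigma$, $\omega$, $\lambda$, $$\|M_\lambda(\cdot\,\sigma)\|_{L^p(\sigma)\to L^q(\omega)}\le C\left(\int\sup_Q\Big(\frac{\omega(Q)}{\sigma(Q)}\Big)^{\frac{q}{p-q}}\lambda_Q^q\,(\Lambda^{\sup}_{q,Q})^{\frac{q^2}{p-q}}1_Q\,\mathrm{d}\omega\right)^{\frac{p-q}{pq}}.$$ (ii) (Necessary condition) For every real $\gamma<q$, $\gamma\ne0$, there is a finite constant $C$ depending only on $\gamma,p,q$ such that, for all $d$, $\sigma$, $\omega$, $\lambda$ satisfying $\lambda_Q=0$ or $\omega(Q)=0$ for every dyadic cube $Q$ with $\sigma(Q)=0$, $$\left(\int\sup_Q\Big(\frac{\omega(Q)}{\sigma(Q)}\Big)^{\frac{q}{p-q}}(\Lambda^{\sup}_{\gamma,Q})^{\frac{pq}{p-q}}1_Q\,\mathrm{d}\omega\right)^{\frac{p-q}{pq}}\le C\,\|M_\lambda(\cdot\,\sigma)\|_{L^p(\sigma)\to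 L^q(\omega)}.$$ -/

import Mathlib

open MeasureTheory
open scoped NNReal ENNReal

noncomputable section

/-- The half-open dyadic cube `∏ᵢ [2⁻ᵏ mᵢ, 2⁻ᵏ (mᵢ + 1))` in `ℝᵈ`. -/
def dyadicBox (d : ℕ) (k : ℤ) (m : Fin d → ℤ) : Set (EuclideanSpace ℝ (Fin d)) :=
  {x | ∀ i, (2 : ℝ) ^ (-k) * (m i : ℝ) ≤ x i ∧ x i < (2 : ℝ) ^ (-k) * ((m i : ℝ) + 1)}

/-- The collection of all dyadic cubes in `ℝᵈ` (all generations `k ∈ ℤ`), as sets. -/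
abbrev DyadicCube (d : ℕ) : Type :=
  {Q : Set (EuclideanSpace ℝ (Fin d)) // ∃ (k : ℤ) (m : Fin d → ℤ), Q = dyadicBox d k m}

/-- The average of `|f|` on `Q` with respect to `μ`. Division in `[0, ∞]` has `0 / 0 = 0`. -/
def cubeAverage {d : ℕ} (μ : Measure (EuclideanSpace ℝ (Fin d)))
    (f : EuclideanSpace ℝ (Fin d) → ℝ) (Q : DyadicCube d) : ℝ≥0∞ :=
  (∫⁻ x in Q.1, ‖f x‖ₑ ∂μ) / μ Q.1

/-- The dyadic maximal operator `M_λ(fσ) = sup_Q λ_Q ⟨f⟩_Q^σ 1_Q`. -/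
def maximalOp {d : ℕ} (σ : Measure (EuclideanSpace ℝ (Fin d))) (lam : DyadicCube d → ℝ≥0)
    (f : EuclideanSpace ℝ (Fin d) → ℝ) (x : EuclideanSpace ℝ (Fin d)) : ℝ≥0∞ :=
  ⨆ Q : DyadicCube d, Q.1.indicator (fun _ => (lam Q : ℝ≥0∞) * cubeAverage σ f Q) x

/-- The norm of `M_λ(· σ)` from `L^p(σ)` to `L^q(ω)`: the least `C ∈ [0, ∞]` such that
`‖M_λ(fσ)‖_{L^q(ω)} ≤ C ‖f‖_{L^p(σ)}` for all `f ∈ L^p(σ)`. -/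
def maximalOpNorm {d : ℕ} (p q : ℝ) (σ ω : Measure (EuclideanSpace ℝ (Fin d)))
    (lam : DyadicCube d → ℝ≥0) : ℝ≥0∞ :=
  sInf {C : ℝ≥0∞ | ∀ f : EuclideanSpace ℝ (Fin d) → ℝ, MemLp f (ENNReal.ofReal p) σ →
    eLpNorm (maximalOp σ lam f) (ENNReal.ofReal q) ω ≤ C * eLpNorm f (ENNReal.ofReal p) σ}

/-- The localized supremum `ρ_Q^sup = sup_{R ⊆ Q} λ_R 1_R`. -/
def rhoSup {d : ℕ} (lam : DyadicCube d → ℝ≥0) (Q : DyadicCube d)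
    (x : EuclideanSpace ℝ (Fin d)) : ℝ≥0∞ :=
  ⨆ (R : DyadicCube d) (_ : R.1 ⊆ Q.1), R.1.indicator (fun _ => (lam R : ℝ≥0∞)) x

/-- The `γ`-average `Λ_{γ,Q}^sup = (ω(Q)⁻¹ ∫_Q (ρ_Q^sup)^γ dω)^{1/γ}`, for `γ ≠ 0`;
for `γ < 0` the powers are taken in `[0, ∞]` (so `0 ^ γ = ∞` and `∞ ^ γ = 0`). -/
def LambdaSup {d : ℕ} (ω : Measure (EuclideanSpace ℝ (Fin d))) (lam : DyadicCube d → ℝ≥0)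
    (γ : ℝ) (Q : DyadicCube d) : ℝ≥0∞ :=
  ((∫⁻ x in Q.1, rhoSup lam Q x ^ γ ∂ω) / ω Q.1) ^ (1 / γ)

/-- `(∫ sup_Q (ω(Q)/σ(Q))^{q/(p-q)} λ_Q^q (Λ_{q,Q}^sup)^{q²/(p-q)} 1_Q dω)^{(p-q)/(pq)}`. -/
def sufficientQuantity {d : ℕ} (p q : ℝ) (σ ω : Measure (EuclideanSpace ℝ (Fin d)))
    (lam : DyadicCube d → ℝ≥0) : ℝ≥0∞ :=
  (∫⁻ x, ⨆ Q : DyadicCube d, Q.1.indicator (fun _ =>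
      (ω Q.1 / σ Q.1) ^ (q / (p - q)) * (lam Q : ℝ≥0∞) ^ q *
        LambdaSup ω lam q Q ^ (q ^ 2 / (p - q))) x ∂ω) ^ ((p - q) / (p * q))

/-- `(∫ sup_Q (ω(Q)/σ(Q))^{q/(p-q)} (Λ_{γ,Q}^sup)^{pq/(p-q)} 1_Q dω)^{(p-q)/(pq)}`. -/
def necessaryQuantity {d : ℕ} (p q γ : ℝ) (σ ω : Measure (EuclideanSpace ℝ (Fin d)))
    (lam : DyadicCube d → ℝ≥0) : ℝ≥0∞ :=
  (∫⁻ x, ⨆ Q : DyadicCube d, Q.1.indicator (fun _ =>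
      (ω Q.1 / σ Q.1) ^ (q / (p - q)) *
        LambdaSup ω lam γ Q ^ (p * q / (p - q))) x ∂ω) ^ ((p - q) / (p * q))

end

/-! ### Dyadic cubes and finite suprema of weighted indicators -/

section Basics

variable {d : ℕ}

/-! Everything rests on one sparse selection (`exists_sparse_subfamily`): a finite weighted family
of cubes can be thinned so that its pointwise sum is at most four times its pointwise supremum,
while every discarded cube lies in a retained one of at least half its weight. Integrated suprema
can thus be traded for sums over cubes. Combined with Hölder and absorption, this yields the `L^r`
maximal theorem for arbitrary locally finite measures, with constants free of dimension
(`lintegral_supOn_avg_rpow_le`).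

For (i), a cube is small or large according to whether its average of `f` is at most a threshold
built from `∫_Q ρ_Q^q dω / σ(Q)`. Small cubes are bounded by the integrand of the condition; large
ones, after thinning, by `∑ ⟨f⟩_R^p σ(R)`, hence by the maximal theorem for `σ`. The resulting
additive bound (`lintegral_supOn_mul_avg_rpow_le`) becomes multiplicative by replacing `f` with `t
f` and optimising in `t`.

For (ii) with `0 < γ < q`, test on `f = sup a_Q 1_Q`, so that `M_λ(fσ) ≥ a_Q ρ_Q` on `Q`. The
maximal theorem for `ω` with exponent `q/γ > 1` brings in `Λ_γ`
(`lintegral_supOn_mul_LambdaSup_rpow_le`). With `a_Q` suitably chosen, thinning bounds `‖f‖_p^p` by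
the very integral being estimated, which is then absorbed. Negative `γ` follows from monotonicity of
power means. -/

instance : Countable (DyadicCube d) := by
  refine Function.Surjective.countable
    (f := fun km : ℤ × (Fin d → ℤ) => (⟨dyadicBox d km.1 km.2, km.1, km.2, rfl⟩ : DyadicCube d)) ?_
  rintro ⟨_, k, m, rfl⟩
  exact ⟨(k, m), rfl⟩

lemma DyadicCube.measurableSet (Q : DyadicCube d) : MeasurableSet Q.1 := by
  obtain ⟨_, k, m, rfl⟩ := Q
  have : dyadicBox d k m = ⋂ i, {x : EuclideanSpace ℝ (Fin d) |
      (2 : ℝ) ^ (-k) * (m i : ℝ) ≤ x i ∧ x i < (2 : ℝ) ^ (-k) * ((m i : ℝ) + 1)} := by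
    ext x; simp [dyadicBox]
  change MeasurableSet (dyadicBox d k m)
  rw [this]
  refine MeasurableSet.iInter fun i => ?_
  have hi : Measurable fun x : EuclideanSpace ℝ (Fin d) => x i := by fun_prop
  exact (measurableSet_le measurable_const hi).inter (measurableSet_lt hi measurable_const)

lemma DyadicCube.measure_ne_top (μ : Measure (EuclideanSpace ℝ (Fin d)))
    [IsLocallyFiniteMeasure μ] (Q : DyadicCube d) : μ Q.1 ≠ ∞ := by
  obtain ⟨_, k, m, rfl⟩ := Q
  have hc : IsCompact ((EuclideanSpace.equiv (Fin d) ℝ).toHomeomorph ⁻¹'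
      Set.Icc (fun i => (2 : ℝ) ^ (-k) * (m i : ℝ)) fun i => (2 : ℝ) ^ (-k) * ((m i : ℝ) + 1)) :=
    (Homeomorph.isCompact_preimage _).2 isCompact_Icc
  refine ne_top_of_le_ne_top hc.measure_lt_top.ne (measure_mono fun x hx => ?_)
  exact ⟨fun i => (hx i).1, fun i => (hx i).2.le⟩

lemma mem_dyadicBox_iff {k : ℤ} {m : Fin d → ℤ} {x : EuclideanSpace ℝ (Fin d)} :
    x ∈ dyadicBox d k m ↔ ∀ i, ⌊(2 : ℝ) ^ k * x i⌋ = m i := by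
  refine forall_congr' fun i => ?_
  have h2 : (0 : ℝ) < 2 ^ k := by positivity
  rw [Int.floor_eq_iff, zpow_neg, inv_mul_le_iff₀ h2, lt_inv_mul_iff₀ h2]

/-- The coarser floor is the integer quotient of the finer one by a power of two; this is what makes
dyadic cubes nested. -/
lemma floor_two_zpow_congr {k l : ℤ} (h : k ≤ l) {x y : ℝ}
    (hxy : ⌊(2 : ℝ) ^ l * x⌋ = ⌊(2 : ℝ) ^ l * y⌋) : ⌊(2 : ℝ) ^ k * x⌋ = ⌊(2 : ℝ) ^ k * y⌋ := by
  obtain ⟨n, rfl⟩ := Int.le.dest h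
  have key : ∀ z : ℝ, ⌊(2 : ℝ) ^ k * z⌋ = ⌊(2 : ℝ) ^ (k + (n : ℤ)) * z⌋ / ((2 ^ n : ℕ) : ℤ) := by
    intro z
    rw [← Int.floor_div_natCast]
    congr 1
    rw [zpow_add₀ two_ne_zero]
    push_cast
    rw [zpow_natCast]
    field_simp
  rw [key x, key y, hxy]

lemma DyadicCube.le_total_of_mem {Q R : DyadicCube d} {x : EuclideanSpace ℝ (Fin d)}
    (hQ : x ∈ Q.1) (hR : x ∈ R.1) : Q ≤ R ∨ R ≤ Q := by
  obtain ⟨_, k, m, rfl⟩ := Q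
  obtain ⟨_, l, n, rfl⟩ := R
  have key : ∀ {k l : ℤ} {m n : Fin d → ℤ}, k ≤ l → x ∈ dyadicBox d k m → x ∈ dyadicBox d l n →
      dyadicBox d l n ⊆ dyadicBox d k m := by
    intro k l m n h hQ hR y hy
    rw [mem_dyadicBox_iff] at *
    intro i
    rw [← hQ i]
    exact floor_two_zpow_congr h ((hy i).trans (hR i).symm)
  rcases le_total k l with h | h
  · exact Or.inr (key h hQ hR)
  · exact Or.inl (key h hR hQ)

/-- The pointwise supremum `sup_{Q ∈ F} c_Q 1_Q` over a finite collection of cubes. -/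
noncomputable def supOn (F : Finset (DyadicCube d)) (c : DyadicCube d → ℝ≥0∞)
    (x : EuclideanSpace ℝ (Fin d)) : ℝ≥0∞ :=
  ⨆ Q ∈ F, Q.1.indicator (fun _ => c Q) x

variable {F G : Finset (DyadicCube d)} {c c' : DyadicCube d → ℝ≥0∞}
  {x : EuclideanSpace ℝ (Fin d)}

lemma le_supOn {Q : DyadicCube d} (hQ : Q ∈ F) (hx : x ∈ Q.1) : c Q ≤ supOn F c x := by
  refine le_trans ?_ (le_iSup₂ (f := fun Q (_ : Q ∈ F) => Q.1.indicator (fun _ => c Q) x) Q hQ)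
  rw [Set.indicator_of_mem hx]

lemma supOn_le {y : ℝ≥0∞} (h : ∀ Q ∈ F, x ∈ Q.1 → c Q ≤ y) : supOn F c x ≤ y :=
  iSup₂_le fun Q hQ => Set.indicator_apply_le' (fun hx => h Q hQ hx) fun _ => zero_le

lemma measurable_supOn : Measurable (supOn F c) :=
  Measurable.iSup fun Q => Measurable.iSup fun _ => measurable_const.indicator Q.measurableSet

lemma supOn_rpow {r : ℝ} (hr : 0 < r) : supOn F (fun Q => c Q ^ r) x = supOn F c x ^ r := by
  refine le_antisymm (supOn_le fun Q hQ hx => ENNReal.rpow_le_rpow (le_supOn hQ hx) hr.le) ?_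
  rw [← ENNReal.le_rpow_inv_iff hr]
  exact supOn_le fun Q hQ hx =>
    (ENNReal.le_rpow_inv_iff hr).2 (le_supOn (c := fun Q => c Q ^ r) hQ hx)

lemma supOn_le_sum : supOn F c x ≤ ∑ Q ∈ F, Q.1.indicator (fun _ => c Q) x :=
  iSup₂_le fun _ hQ => Finset.single_le_sum
    (f := fun Q : DyadicCube d => Q.1.indicator (fun _ => c Q) x) (fun _ _ => zero_le) hQ

lemma lintegral_sum_indicator (μ : Measure (EuclideanSpace ℝ (Fin d))) :
    ∫⁻ x, ∑ Q ∈ F, Q.1.indicator (fun _ => c Q) x ∂μ = ∑ Q ∈ F, c Q * μ Q.1 := by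
  rw [lintegral_finsetSum _ fun Q _ => measurable_const.indicator Q.measurableSet]
  exact Finset.sum_congr rfl fun Q _ => lintegral_indicator_const Q.measurableSet _

lemma lintegral_supOn_le_sum (μ : Measure (EuclideanSpace ℝ (Fin d))) :
    ∫⁻ x, supOn F c x ∂μ ≤ ∑ Q ∈ F, c Q * μ Q.1 :=
  (lintegral_mono fun _ => supOn_le_sum).trans_eq (lintegral_sum_indicator μ)

lemma lintegral_supOn_ne_top (μ : Measure (EuclideanSpace ℝ (Fin d))) [IsLocallyFiniteMeasure μ]
    (hc : ∀ Q ∈ F, c Q ≠ ∞) : ∫⁻ x, supOn F c x ∂μ ≠ ∞ :=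
  ne_top_of_le_ne_top (ENNReal.sum_ne_top.2 fun Q hQ =>
    ENNReal.mul_ne_top (hc Q hQ) (Q.measure_ne_top μ)) (lintegral_supOn_le_sum μ)

/-- Monotone convergence from finite collections of cubes to all cubes. -/
lemma lintegral_iSup_indicator_eq_iSup_finset (μ : Measure (EuclideanSpace ℝ (Fin d))) :
    ∫⁻ x, ⨆ Q : DyadicCube d, Q.1.indicator (fun _ => c Q) x ∂μ =
      ⨆ F : Finset (DyadicCube d), ∫⁻ x, supOn F c x ∂μ := by
  classical
  rw [← lintegral_iSup_directed (fun F => measurable_supOn.aemeasurable)]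
  · refine lintegral_congr fun x => ?_
    rw [iSup_eq_iSup_finset]
    rfl
  · intro F G
    exact ⟨F ∪ G,
      fun x => supOn_le fun Q hQ hx => le_supOn (Finset.mem_union_left _ hQ) hx,
      fun x => supOn_le fun Q hQ hx => le_supOn (Finset.mem_union_right _ hQ) hx⟩

end Basics

/-! ### Sparse selection -/

section Sparse

variable {d : ℕ}

lemma sum_two_zpow_le (T : Finset ℤ) (K : ℤ) (hT : ∀ k ∈ T, k ≤ K) :
    ∑ k ∈ T, (2 : ℝ≥0∞) ^ k ≤ 2 * 2 ^ K := by
  have hinj : Set.InjOn (fun k : ℤ => (K - k).toNat) T := by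
    intro k hk l hl h
    have := hT k hk; have := hT l hl
    simp only at h
    omega
  have hterm : ∀ k ∈ T, (2 : ℝ≥0∞) ^ k = 2 ^ K * (2⁻¹) ^ (K - k).toNat := by
    intro k hk
    have hk' := hT k hk
    rw [← ENNReal.inv_pow, ← zpow_natCast, Int.toNat_of_nonneg (by omega), ← ENNReal.zpow_neg,
      ← ENNReal.zpow_add two_ne_zero ENNReal.ofNat_ne_top]
    congr 1; ring
  rw [Finset.sum_congr rfl hterm, ← Finset.mul_sum, mul_comm]
  gcongr
  rw [← Finset.sum_image (f := fun n : ℕ => (2⁻¹ : ℝ≥0∞) ^ n) hinj]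
  refine (ENNReal.sum_le_tsum _).trans_eq ?_
  rw [ENNReal.tsum_geometric]
  simp

/-- Every finite collection of dyadic cubes with finite coefficients has a subcollection that
dominates it from above and along which the coefficients grow geometrically. -/
lemma exists_sparse_subfamily (F : Finset (DyadicCube d)) (c : DyadicCube d → ℝ≥0∞)
    (hc : ∀ Q ∈ F, c Q ≠ ∞) :
    ∃ G ⊆ F, (∀ Q ∈ F, c Q ≠ 0 → ∃ R ∈ G, Q ≤ R ∧ c Q ≤ 2 * c R) ∧
      ∀ x, ∑ Q ∈ G, Q.1.indicator (fun _ => c Q) x ≤ 4 * supOn F c x := by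
  classical
  have hlev : ∀ Q : DyadicCube d, ∃ k : ℤ, Q ∈ F → c Q ≠ 0 →
      2 ^ k ≤ c Q ∧ c Q < 2 ^ (k + 1) := by
    intro Q
    by_cases h : Q ∈ F ∧ c Q ≠ 0
    · obtain ⟨k, hk⟩ := ENNReal.exists_mem_Ico_zpow h.2 (hc Q h.1) ENNReal.one_lt_two
        ENNReal.ofNat_ne_top
      exact ⟨k, fun _ _ => ⟨hk.1, hk.2⟩⟩
    · exact ⟨0, fun h1 h2 => (h ⟨h1, h2⟩).elim⟩
  choose k hk using hlev
  have h2 : ∀ n : ℤ, (2 : ℝ≥0∞) ^ (n + 1) = 2 * 2 ^ n := fun n => by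
    rw [ENNReal.zpow_add two_ne_zero ENNReal.ofNat_ne_top, zpow_one, mul_comm]
  set F₀ := F.filter fun Q => c Q ≠ 0 with hF₀
  -- Keep the cubes whose dyadic level strictly exceeds that of every larger cube of nonzero weight.
  refine ⟨F₀.filter fun Q => ∀ R ∈ F₀, Q < R → k R < k Q,
    (Finset.filter_subset _ _).trans (Finset.filter_subset _ _), fun Q hQ hQ0 => ?_, fun x => ?_⟩
  -- An inclusion-maximal cube above `Q` of level at least `k Q` is automatically kept.
  · obtain ⟨R, hR⟩ := (F₀.filter fun R => Q ≤ R ∧ k Q ≤ k R).exists_maximal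
      ⟨Q, by simp [hF₀, hQ, hQ0]⟩
    have hRm := hR.prop
    simp only [Finset.mem_filter] at hRm
    obtain ⟨hRF, hQR, hkQR⟩ := hRm
    have hRF' := Finset.mem_filter.1 hRF
    refine ⟨R, Finset.mem_filter.2 ⟨hRF, fun R' hR' hlt => ?_⟩, hQR, ?_⟩
    · by_contra! hcon
      exact hlt.not_ge (hR.2 (Finset.mem_filter.2
        ⟨hR', hQR.trans hlt.le, hkQR.trans hcon⟩) hlt.le)
    · calc c Q ≤ 2 ^ (k Q + 1) := (hk Q hQ hQ0).2.le
        _ = 2 * 2 ^ k Q := h2 _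
        _ ≤ 2 * 2 ^ k R := by
          exact mul_le_mul_right (ENNReal.zpow_le_of_le one_le_two hkQR) 2
        _ ≤ 2 * c R := by
          gcongr
          exact (hk R hRF'.1 hRF'.2).1
  · set G := F₀.filter fun Q => ∀ R ∈ F₀, Q < R → k R < k Q
    have hG : ∀ Q ∈ G, Q ∈ F ∧ c Q ≠ 0 := fun Q hQ =>
      Finset.mem_filter.1 (Finset.mem_filter.1 hQ).1
    set T := G.filter fun Q => x ∈ Q.1
    have hsum : ∑ Q ∈ G, Q.1.indicator (fun _ => c Q) x = ∑ Q ∈ T, c Q := by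
      rw [Finset.sum_filter (s := G)]
      exact Finset.sum_congr rfl fun Q _ => by rw [Set.indicator_apply]
    rw [hsum]
    rcases T.eq_empty_or_nonempty with hT | hT
    · simp [hT]
    -- Kept cubes through `x` are nested, so their levels are distinct and the sum at `x` is
    -- dominated by a geometric series.
    have hinj : Set.InjOn k T := by
      intro Q hQ R hR hQR
      obtain ⟨hQG, hQx⟩ := Finset.mem_filter.1 (Finset.mem_coe.1 hQ)
      obtain ⟨hRG, hRx⟩ := Finset.mem_filter.1 (Finset.mem_coe.1 hR)
      by_contra hne
      rcases DyadicCube.le_total_of_mem hQx hRx with h | h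
      · have := (Finset.mem_filter.1 hQG).2 R (Finset.mem_filter.1 hRG).1 (lt_of_le_of_ne h hne)
        omega
      · have := (Finset.mem_filter.1 hRG).2 Q (Finset.mem_filter.1 hQG).1
          (lt_of_le_of_ne h (Ne.symm hne))
        omega
    obtain ⟨Q₀, hQ₀, hmax⟩ := T.exists_max_image k hT
    obtain ⟨hQ₀G, hQ₀x⟩ := Finset.mem_filter.1 hQ₀
    calc ∑ Q ∈ T, c Q ≤ ∑ Q ∈ T, 2 * (2 : ℝ≥0∞) ^ k Q := Finset.sum_le_sum fun Q hQ => by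
          have := hG Q (Finset.mem_filter.1 hQ).1
          rw [← h2]
          exact (hk Q this.1 this.2).2.le
      _ = 2 * ∑ n ∈ T.image k, (2 : ℝ≥0∞) ^ n := by
          rw [← Finset.mul_sum, Finset.sum_image hinj]
      _ ≤ 2 * (2 * 2 ^ k Q₀) := by
          gcongr
          refine sum_two_zpow_le _ _ fun n hn => ?_
          obtain ⟨Q, hQ, rfl⟩ := Finset.mem_image.1 hn
          exact hmax Q hQ
      _ = 4 * 2 ^ k Q₀ := by rw [← mul_assoc]; norm_num
      _ ≤ 4 * supOn F c x := by
          gcongr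
          exact (hk Q₀ (hG Q₀ hQ₀G).1 (hG Q₀ hQ₀G).2).1.trans (le_supOn (hG Q₀ hQ₀G).1 hQ₀x)

end Sparse
-- The dyadic maximal theorem for arbitrary measures
section Maximal

variable {d : ℕ}

/-- Absorption: divide by `X ^ θ`. The need for `X` finite is why the arguments run over finite
families of cubes. -/
lemma ENNReal.le_rpow_of_le_mul_rpow {X K : ℝ≥0∞} {θ : ℝ} (hθ : θ < 1) (hX : X ≠ ∞)
    (h : X ≤ K * X ^ θ) : X ≤ K ^ (1 - θ)⁻¹ := by
  rcases eq_or_ne X 0 with rfl | h0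
  · exact zero_le
  rw [ENNReal.le_rpow_inv_iff (by linarith)]
  have hpos : X ^ θ ≠ 0 := (ENNReal.rpow_pos (pos_iff_ne_zero.2 h0) hX).ne'
  have htop : X ^ θ ≠ ∞ := ENNReal.rpow_ne_top_of_ne_zero h0 hX
  have hsplit : X ^ (1 - θ) = X / X ^ θ := by
    rw [ENNReal.rpow_sub _ _ h0 hX, ENNReal.rpow_one]
  rw [hsplit]
  exact (ENNReal.div_le_iff_le_mul (Or.inl hpos) (Or.inl htop)).2 h

/-- The average of a nonnegative function over a dyadic cube. -/
noncomputable def avg (μ : Measure (EuclideanSpace ℝ (Fin d)))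
    (g : EuclideanSpace ℝ (Fin d) → ℝ≥0∞) (Q : DyadicCube d) : ℝ≥0∞ :=
  (∫⁻ x in Q.1, g x ∂μ) / μ Q.1

variable {μ : Measure (EuclideanSpace ℝ (Fin d))} {g : EuclideanSpace ℝ (Fin d) → ℝ≥0∞}

lemma avg_mul_measure_le (Q : DyadicCube d) : avg μ g Q * μ Q.1 ≤ ∫⁻ x in Q.1, g x ∂μ := by
  rw [mul_comm]
  exact ENNReal.mul_div_le

lemma le_avg [IsLocallyFiniteMeasure μ] {Q : DyadicCube d} {a : ℝ≥0∞} (hQ : μ Q.1 ≠ 0)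
    (h : ∀ x ∈ Q.1, a ≤ g x) : a ≤ avg μ g Q := by
  rw [avg, ENNReal.le_div_iff_mul_le (Or.inl hQ) (Or.inl (Q.measure_ne_top μ))]
  calc a * μ Q.1 = ∫⁻ _ in Q.1, a ∂μ := (setLIntegral_const _ _).symm
    _ ≤ _ := setLIntegral_mono_ae' Q.measurableSet (ae_of_all _ h)

lemma avg_eq_zero_of_measure_eq_zero {Q : DyadicCube d} (h : μ Q.1 = 0) : avg μ g Q = 0 := by
  rw [avg, setLIntegral_measure_zero _ _ h, ENNReal.zero_div]

lemma avg_const_mul {a : ℝ≥0∞} (ha : a ≠ ∞) (Q : DyadicCube d) :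
    avg μ (fun x => a * g x) Q = a * avg μ g Q := by
  rw [avg, lintegral_const_mul' _ _ ha, avg, mul_div_assoc]

lemma avg_ne_top [IsLocallyFiniteMeasure μ] {r : ℝ} (hr : 1 ≤ r) (hg : AEMeasurable g μ)
    (hgr : ∫⁻ x, g x ^ r ∂μ ≠ ∞) (Q : DyadicCube d) : avg μ g Q ≠ ∞ := by
  rcases eq_or_ne (μ Q.1) 0 with h0 | h0
  · simp [avg_eq_zero_of_measure_eq_zero h0]
  have hr0 : 0 < r := by linarith
  refine ENNReal.div_ne_top ?_ h0
  have h := ENNReal.lintegral_mul_norm_pow_le (μ := μ.restrict Q.1) (f := fun x => g x ^ r)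
    (g := fun _ => 1) (p := r⁻¹) (q := 1 - r⁻¹) (hg.restrict.pow_const r) aemeasurable_const
    (by positivity) (by rw [sub_nonneg]; exact inv_le_one_of_one_le₀ hr) (by ring)
  simp only [ENNReal.one_rpow, mul_one, ENNReal.rpow_rpow_inv hr0.ne', lintegral_one,
    Measure.restrict_apply_univ] at h
  refine ne_top_of_le_ne_top (ENNReal.mul_ne_top ?_ ?_) h
  · exact ENNReal.rpow_ne_top_of_nonneg (by positivity)
      (ne_top_of_le_ne_top hgr (setLIntegral_le_lintegral _ _))
  · exact ENNReal.rpow_ne_top_of_nonneg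
      (by rw [sub_nonneg]; exact inv_le_one_of_one_le₀ hr) (Q.measure_ne_top μ)

/-- The constant in the dyadic maximal theorem. -/
noncomputable def maximalConst (r : ℝ) : ℝ≥0∞ := (2 ^ (r / (r - 1)) * 4) ^ r

lemma maximalConst_ne_zero {r : ℝ} (hr : 1 < r) : maximalConst r ≠ 0 := by
  have h : (0 : ℝ≥0∞) < 2 ^ (r / (r - 1)) := ENNReal.rpow_pos (by norm_num) (by norm_num)
  rw [maximalConst, Ne, ENNReal.rpow_eq_zero_iff_of_pos (by linarith)]
  exact mul_ne_zero h.ne' (by norm_num)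

lemma maximalConst_ne_top {r : ℝ} (hr : 1 < r) : maximalConst r ≠ ∞ := by
  have : 0 ≤ r / (r - 1) := div_nonneg (by linarith) (by linarith)
  exact ENNReal.rpow_ne_top_of_nonneg (by linarith)
    (ENNReal.mul_ne_top (ENNReal.rpow_ne_top_of_nonneg this (by norm_num)) (by norm_num))

/-- The `L^r` bound, `r > 1`, for the dyadic maximal operator of an arbitrary locally finite
measure, restricted to finitely many cubes. -/
theorem lintegral_supOn_avg_rpow_le [IsLocallyFiniteMeasure μ] {r : ℝ} (hr : 1 < r)
    (hg : AEMeasurable g μ) (F : Finset (DyadicCube d)) :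
    ∫⁻ x, supOn F (avg μ g) x ^ r ∂μ ≤ maximalConst r * ∫⁻ x, g x ^ r ∂μ := by
  have hr0 : 0 < r := by linarith
  have hr1 : 0 < r - 1 := by linarith
  rcases eq_or_ne (∫⁻ x, g x ^ r ∂μ) ∞ with htop | htop
  · rw [htop, ENNReal.mul_top (maximalConst_ne_zero hr)]
    exact le_top
  have hfin : ∀ Q, avg μ g Q ≠ ∞ := avg_ne_top hr.le hg htop
  have hfin1 : ∀ Q, avg μ g Q ^ (r - 1) ≠ ∞ := fun Q =>
    ENNReal.rpow_ne_top_of_nonneg hr1.le (hfin Q)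
  -- The weight has exponent `r - 1`, not `r`: the remaining factor of the average is spent on
  -- turning `μ(Q)` into `∫_Q g`.
  obtain ⟨G, -, hdom, hsum⟩ :=
    exists_sparse_subfamily F (fun Q => avg μ g Q ^ (r - 1)) fun Q _ => hfin1 Q
  set X := ∫⁻ x, supOn F (avg μ g) x ^ r ∂μ with hX
  have hXtop : X ≠ ∞ := by
    simp_rw [hX, ← supOn_rpow hr0]
    exact lintegral_supOn_ne_top μ fun Q _ => ENNReal.rpow_ne_top_of_nonneg hr0.le (hfin Q)
  have hpt : ∀ x, supOn F (avg μ g) x ^ r ≤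
      2 ^ (r / (r - 1)) * supOn G (fun Q => avg μ g Q ^ r) x := by
    intro x
    rw [← supOn_rpow hr0]
    refine supOn_le fun Q hQ hx => ?_
    rcases eq_or_ne (avg μ g Q) 0 with h0 | h0
    · simp [h0, hr0]
    obtain ⟨R, hR, hQR, hle⟩ := hdom Q hQ (by simp [h0, hfin Q])
    have hle' := ENNReal.rpow_le_rpow hle (div_pos hr0 hr1).le
    rw [ENNReal.mul_rpow_of_nonneg _ _ (div_pos hr0 hr1).le, ← ENNReal.rpow_mul,
      ← ENNReal.rpow_mul, mul_div_cancel₀ _ hr1.ne'] at hle'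
    exact hle'.trans (mul_le_mul_right
      (le_supOn (c := fun Q => avg μ g Q ^ r) hR (hQR hx)) _)
  have hsp : ∫⁻ x, supOn G (fun Q => avg μ g Q ^ r) x ∂μ ≤
      4 * ∫⁻ x, (g x ^ r) ^ r⁻¹ * (supOn F (avg μ g) x ^ r) ^ (1 - r⁻¹) ∂μ := by
    calc ∫⁻ x, supOn G (fun Q => avg μ g Q ^ r) x ∂μ
        ≤ ∑ Q ∈ G, avg μ g Q ^ r * μ Q.1 := lintegral_supOn_le_sum μ
      _ ≤ ∑ Q ∈ G, ∫⁻ x, Q.1.indicator (fun _ => avg μ g Q ^ (r - 1)) x * g x ∂μ := by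
        refine Finset.sum_le_sum fun Q _ => ?_
        have h1 : ∀ x, Q.1.indicator (fun _ => avg μ g Q ^ (r - 1)) x * g x =
            Q.1.indicator (fun x => avg μ g Q ^ (r - 1) * g x) x := fun x => by
          by_cases hx : x ∈ Q.1 <;> simp [hx]
        simp_rw [h1]
        rw [lintegral_indicator Q.measurableSet, lintegral_const_mul' _ _ (hfin1 Q)]
        have h2 : avg μ g Q ^ r = avg μ g Q ^ (r - 1) * avg μ g Q := by
          conv_lhs => rw [show r = (r - 1) + 1 by ring]
          rw [ENNReal.rpow_add_of_nonneg _ _ hr1.le zero_le_one, ENNReal.rpow_one]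
        rw [h2, mul_assoc]
        exact mul_le_mul_right (avg_mul_measure_le Q) _
      _ = ∫⁻ x, (∑ Q ∈ G, Q.1.indicator (fun _ => avg μ g Q ^ (r - 1)) x) * g x ∂μ := by
        simp_rw [Finset.sum_mul]
        exact (lintegral_finsetSum' _ fun Q _ =>
          (measurable_const.indicator Q.measurableSet).aemeasurable.mul hg).symm
      _ ≤ ∫⁻ x, 4 * ((g x ^ r) ^ r⁻¹ * (supOn F (avg μ g) x ^ r) ^ (1 - r⁻¹)) ∂μ := by
        refine lintegral_mono fun x => ?_
        have h3 : r * (1 - r⁻¹) = r - 1 := by field_simp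
        rw [ENNReal.rpow_rpow_inv hr0.ne', ← ENNReal.rpow_mul, h3, ← supOn_rpow hr1,
          mul_comm (g x), ← mul_assoc]
        exact mul_le_mul_left (hsum x) _
      _ = _ := lintegral_const_mul' _ _ (by norm_num)
  have hinv : 0 ≤ 1 - r⁻¹ := by
    rw [sub_nonneg]; exact inv_le_one_of_one_le₀ hr.le
  have hH := ENNReal.lintegral_mul_norm_pow_le (μ := μ) (f := fun x => g x ^ r)
    (g := fun x => supOn F (avg μ g) x ^ r) (p := r⁻¹) (q := 1 - r⁻¹) (hg.pow_const r)
    (measurable_supOn.aemeasurable.pow_const r) (by positivity) hinv (by ring)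
  have hmain : X ≤ (2 ^ (r / (r - 1)) * 4 * (∫⁻ x, g x ^ r ∂μ) ^ r⁻¹) * X ^ (1 - r⁻¹) := by
    calc X ≤ ∫⁻ x, 2 ^ (r / (r - 1)) * supOn G (fun Q => avg μ g Q ^ r) x ∂μ :=
          lintegral_mono hpt
      _ = 2 ^ (r / (r - 1)) * ∫⁻ x, supOn G (fun Q => avg μ g Q ^ r) x ∂μ :=
          lintegral_const_mul _ measurable_supOn
      _ ≤ 2 ^ (r / (r - 1)) * (4 * ((∫⁻ x, g x ^ r ∂μ) ^ r⁻¹ * X ^ (1 - r⁻¹))) := by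
          gcongr
          exact hsp.trans (mul_le_mul_right hH _)
      _ = _ := by ring
  have hfinal := ENNReal.le_rpow_of_le_mul_rpow (by simpa using hr0) hXtop hmain
  rwa [sub_sub_cancel, inv_inv, ENNReal.mul_rpow_of_nonneg _ _ hr0.le,
    ENNReal.rpow_inv_rpow hr0.ne'] at hfinal

end Maximal

/-! ### Sufficiency: the additive estimate -/

section Sufficient

variable {d : ℕ}

lemma measurable_rhoSup (lam : DyadicCube d → ℝ≥0) (Q : DyadicCube d) :
    Measurable (rhoSup lam Q) :=
  Measurable.iSup fun R => Measurable.iSup fun _ => measurable_const.indicator R.measurableSet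

lemma le_rhoSup {lam : DyadicCube d → ℝ≥0} {Q R : DyadicCube d} (h : Q ≤ R)
    {x : EuclideanSpace ℝ (Fin d)} (hx : x ∈ Q.1) : (lam Q : ℝ≥0∞) ≤ rhoSup lam R x := by
  refine le_trans ?_ (le_iSup₂ (f := fun (Q : DyadicCube d) (_ : Q.1 ⊆ R.1) =>
    Q.1.indicator (fun _ => (lam Q : ℝ≥0∞)) x) Q h)
  rw [Set.indicator_of_mem hx]

/-- The additive form of the sufficient condition: the cubes on which the average of `g` is small
are controlled by the integrated supremum, the others by the maximal theorem. -/
lemma lintegral_supOn_mul_avg_rpow_le {p q : ℝ} (hp : 1 < p) (hq : 0 < q) (hqp : q < p)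
    (σ ω : Measure (EuclideanSpace ℝ (Fin d))) [IsLocallyFiniteMeasure σ]
    (lam : DyadicCube d → ℝ≥0) (F : Finset (DyadicCube d))
    {g : EuclideanSpace ℝ (Fin d) → ℝ≥0∞} (hg : AEMeasurable g σ)
    (hP : ∫⁻ x, g x ^ p ∂σ ≠ ∞) :
    ∫⁻ x, supOn F (fun Q => (lam Q * avg σ g Q) ^ q) x ∂ω ≤
      ∫⁻ x, ⨆ Q : DyadicCube d, Q.1.indicator (fun _ => (lam Q : ℝ≥0∞) ^ q *
        ((∫⁻ y in Q.1, rhoSup lam Q y ^ q ∂ω) / σ Q.1) ^ (q / (p - q))) x ∂ω +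
      2 ^ (q / p) * (4 * maximalConst p) * ∫⁻ x, g x ^ p ∂σ := by
  classical
  have hp0 : 0 < p := by linarith
  have hpq : 0 < p - q := by linarith
  have hs : 0 < q / (p - q) := div_pos hq hpq
  set ν : DyadicCube d → ℝ≥0∞ := fun Q => ∫⁻ y in Q.1, rhoSup lam Q y ^ q ∂ω with hν
  set small : DyadicCube d → Prop := fun Q => avg σ g Q ^ q ≤ (ν Q / σ Q.1) ^ (q / (p - q))
  set c : DyadicCube d → ℝ≥0∞ := fun Q => (lam Q * avg σ g Q) ^ q
  set F₂ := F.filter fun Q => ¬ small Q with hF₂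
  have hsplit : ∀ x, supOn F c x ≤ supOn (F.filter small) c x + supOn F₂ c x := fun x =>
    supOn_le fun Q hQ hx => by
      by_cases h : small Q
      · exact (le_supOn (F := F.filter small) (c := c)
          (Finset.mem_filter.2 ⟨hQ, h⟩) hx).trans le_self_add
      · exact (le_supOn (F := F₂) (c := c)
          (Finset.mem_filter.2 ⟨hQ, h⟩) hx).trans le_add_self
  refine (lintegral_mono hsplit).trans ?_
  rw [lintegral_add_left measurable_supOn]
  gcongr with x
  · refine supOn_le fun Q hQ hx => ?_
    refine le_trans ?_ (le_iSup _ Q)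
    rw [Set.indicator_of_mem hx]
    simp only [c]
    rw [ENNReal.mul_rpow_of_nonneg _ _ hq.le]
    exact mul_le_mul_right (Finset.mem_filter.1 hQ).2 _
  have hfin : ∀ Q, avg σ g Q ≠ ∞ := avg_ne_top hp.le hg hP
  obtain ⟨G, hGF, hdom, hsum⟩ := exists_sparse_subfamily F₂ (fun Q => avg σ g Q ^ p)
    fun Q _ => ENNReal.rpow_ne_top_of_nonneg hp0.le (hfin Q)
  -- Failure of smallness says `ν R / σ(R) < ⟨g⟩_R^(p-q)`; it also forces `σ(R) ≠ 0`.
  have hν_le : ∀ R ∈ G, avg σ g R ^ q * ν R ≤ avg σ g R ^ p * σ R.1 := by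
    intro R hR
    have hlarge : (ν R / σ R.1) ^ (q / (p - q)) < avg σ g R ^ q :=
      not_le.1 (Finset.mem_filter.1 (hGF hR)).2
    have hσ0 : σ R.1 ≠ 0 := fun h0 => by
      rw [avg_eq_zero_of_measure_eq_zero h0, ENNReal.zero_rpow_of_pos hq] at hlarge
      exact not_lt_zero hlarge
    have h1 : ν R / σ R.1 ≤ avg σ g R ^ (p - q) := by
      have h2 : avg σ g R ^ q = (avg σ g R ^ (p - q)) ^ (q / (p - q)) := by
        rw [← ENNReal.rpow_mul, mul_div_cancel₀ _ hpq.ne']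
      rw [h2] at hlarge
      exact (ENNReal.rpow_lt_rpow_iff hs).1 hlarge |>.le
    rw [ENNReal.div_le_iff_le_mul (Or.inl hσ0) (Or.inl (R.measure_ne_top σ))] at h1
    calc avg σ g R ^ q * ν R ≤ avg σ g R ^ q * (avg σ g R ^ (p - q) * σ R.1) := by gcongr
      _ = avg σ g R ^ p * σ R.1 := by
        rw [← mul_assoc, ← ENNReal.rpow_add_of_nonneg _ _ hq.le hpq.le, add_sub_cancel]
  -- Moving from `Q` up to its dominating `R` changes the average by a constant factor only, and all
  -- the `λ_Q` involved are absorbed by the localized supremum on `R`.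
  have hpt : ∀ x, supOn F₂ c x ≤ 2 ^ (q / p) *
      ∑ R ∈ G, R.1.indicator (fun x => avg σ g R ^ q * rhoSup lam R x ^ q) x := by
    refine fun x => supOn_le fun Q hQ hx => ?_
    rcases eq_or_ne (avg σ g Q) 0 with h0 | h0
    · simp [c, h0, hq]
    obtain ⟨R, hR, hQR, hle⟩ := hdom Q hQ (by simp [h0, hfin Q])
    have hqp' : 0 ≤ q / p := by positivity
    have hle' := ENNReal.rpow_le_rpow hle hqp'
    rw [ENNReal.mul_rpow_of_nonneg _ _ hqp', ← ENNReal.rpow_mul, ← ENNReal.rpow_mul,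
      mul_div_cancel₀ _ hp0.ne'] at hle'
    calc c Q = avg σ g Q ^ q * (lam Q : ℝ≥0∞) ^ q := by
          simp only [c]
          rw [ENNReal.mul_rpow_of_nonneg _ _ hq.le, mul_comm]
      _ ≤ 2 ^ (q / p) * avg σ g R ^ q * rhoSup lam R x ^ q := by
          gcongr
          exact le_rhoSup hQR hx
      _ = 2 ^ (q / p) * R.1.indicator (fun x => avg σ g R ^ q * rhoSup lam R x ^ q) x := by
          rw [Set.indicator_of_mem (hQR hx), mul_assoc]
      _ ≤ _ := by
          gcongr
          exact Finset.single_le_sum (f := fun R : DyadicCube d =>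
            R.1.indicator (fun x => avg σ g R ^ q * rhoSup lam R x ^ q) x)
            (fun _ _ => zero_le) hR
  have hmeas : ∀ R : DyadicCube d, Measurable fun x => avg σ g R ^ q * rhoSup lam R x ^ q :=
    fun R => ((measurable_rhoSup lam R).pow_const q).const_mul _
  calc ∫⁻ x, supOn F₂ c x ∂ω
      ≤ ∫⁻ x, 2 ^ (q / p) *
        ∑ R ∈ G, R.1.indicator (fun x => avg σ g R ^ q * rhoSup lam R x ^ q) x ∂ω :=
        lintegral_mono hpt
    _ = 2 ^ (q / p) * ∑ R ∈ G, avg σ g R ^ q * ν R := by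
        rw [lintegral_const_mul _ (Finset.measurable_fun_sum _ fun R _ =>
          (hmeas R).indicator R.measurableSet), lintegral_finsetSum _ fun R _ =>
          (hmeas R).indicator R.measurableSet]
        congr 1
        refine Finset.sum_congr rfl fun R _ => ?_
        rw [lintegral_indicator R.measurableSet,
          lintegral_const_mul _ ((measurable_rhoSup lam R).pow_const q)]
    _ ≤ 2 ^ (q / p) * ∑ R ∈ G, avg σ g R ^ p * σ R.1 := by
        exact mul_le_mul_right (Finset.sum_le_sum hν_le) _
    _ ≤ 2 ^ (q / p) * (4 * (maximalConst p * ∫⁻ x, g x ^ p ∂σ)) := by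
        gcongr
        rw [← lintegral_sum_indicator]
        refine (lintegral_mono hsum).trans ?_
        rw [lintegral_const_mul _ measurable_supOn]
        simp_rw [supOn_rpow hp0]
        gcongr
        exact lintegral_supOn_avg_rpow_le hp hg F₂
    _ = _ := by ring

end Sufficient
-- Sufficiency: from the additive to the multiplicative estimate
section Sufficient

variable {d : ℕ}

/-- Optimising a two-term estimate over all dilations. -/
lemma ENNReal.le_mul_rpow_mul_rpow_of_forall_dilation {p q : ℝ} (hq : 0 < q) (hqp : q < p)
    {Z Y P C : ℝ≥0∞} (hY : Y ≠ ∞) (hP : P ≠ ∞) (hC : C ≠ ∞)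
    (h : ∀ t : ℝ≥0∞, t ≠ 0 → t ≠ ∞ → t ^ q * Z ≤ Y + C * (t ^ p * P)) :
    Z ≤ (1 + C) * (Y ^ (1 - q / p) * P ^ (q / p)) := by
  have hp : 0 < p := hq.trans hqp
  have hθ : 0 < q / p := div_pos hq hp
  have hθ1 : 0 < 1 - q / p := by rw [sub_pos, div_lt_one hp]; exact hqp
  -- Perturbing by `ε` keeps the optimal dilation `t = (Y / P)^(1/p)` away from `0` and `∞`; `ε → 0`
  -- at the end.
  have key : ∀ ε : ℝ≥0∞, ε ≠ 0 → ε ≠ ∞ →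
      Z ≤ (1 + C) * ((Y + ε) ^ (1 - q / p) * (P + ε) ^ (q / p)) := by
    intro ε hε hε'
    set Y' := Y + ε
    set P' := P + ε
    have hY0 : Y' ≠ 0 := fun h => hε (add_eq_zero.1 h).2
    have hP0 : P' ≠ 0 := fun h => hε (add_eq_zero.1 h).2
    have hYt : Y' ≠ ∞ := ENNReal.add_ne_top.2 ⟨hY, hε'⟩
    have hPt : P' ≠ ∞ := ENNReal.add_ne_top.2 ⟨hP, hε'⟩
    have hD0 : Y' / P' ≠ 0 := ENNReal.div_ne_zero.2 ⟨hY0, hPt⟩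
    have hDt : Y' / P' ≠ ∞ := ENNReal.div_ne_top hYt hP0
    have ht := h ((Y' / P') ^ p⁻¹)
      (ENNReal.rpow_pos (pos_iff_ne_zero.2 hD0) hDt).ne' (ENNReal.rpow_ne_top_of_ne_zero hD0 hDt)
    rw [ENNReal.rpow_inv_rpow hp.ne', ← ENNReal.rpow_mul, inv_mul_eq_div] at ht
    have hbound : Y + C * (Y' / P' * P) ≤ (1 + C) * Y' := by
      rw [add_mul, one_mul]
      gcongr
      · exact le_self_add
      · calc Y' / P' * P ≤ Y' / P' * P' := by gcongr; exact le_self_add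
          _ = Y' := ENNReal.div_mul_cancel hP0 hPt
    have hD0' : (Y' / P') ^ (q / p) ≠ 0 := (ENNReal.rpow_pos (pos_iff_ne_zero.2 hD0) hDt).ne'
    have hDt' : (Y' / P') ^ (q / p) ≠ ∞ := ENNReal.rpow_ne_top_of_ne_zero hD0 hDt
    have hsplit : Y' = (Y' / P') ^ (q / p) * (Y' ^ (1 - q / p) * P' ^ (q / p)) := by
      rw [ENNReal.div_rpow_of_nonneg _ _ hθ.le, mul_left_comm,
        ENNReal.div_mul_cancel (ENNReal.rpow_pos (pos_iff_ne_zero.2 hP0) hPt).ne'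
          (ENNReal.rpow_ne_top_of_ne_zero hP0 hPt), ← ENNReal.rpow_add _ _ hY0 hYt,
        sub_add_cancel, ENNReal.rpow_one]
    have hcancel := ht.trans hbound
    nth_rewrite 2 [hsplit] at hcancel
    rw [mul_left_comm] at hcancel
    exact (ENNReal.mul_le_mul_iff_right hD0' hDt').1 hcancel
  have hY1 : Y ^ (1 - q / p) ≠ ∞ := ENNReal.rpow_ne_top_of_nonneg hθ1.le hY
  have hP1 : P ^ (q / p) ≠ ∞ := ENNReal.rpow_ne_top_of_nonneg hθ.le hP
  have hadd : ∀ {a : ℝ≥0∞} {θ : ℝ}, Filter.Tendsto (fun ε : ℝ≥0∞ => (a + ε) ^ θ)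
      (nhdsWithin 0 (Set.Ioi 0)) (nhds (a ^ θ)) := by
    intro a θ
    have : Filter.Tendsto (fun ε : ℝ≥0∞ => (a + ε) ^ θ) (nhds 0) (nhds ((a + 0) ^ θ)) :=
      ((ENNReal.continuous_rpow_const (y := θ)).comp (continuous_const.add continuous_id)).tendsto 0
    rw [add_zero] at this
    exact this.mono_left nhdsWithin_le_nhds
  have hlim : Filter.Tendsto
      (fun ε : ℝ≥0∞ => (1 + C) * ((Y + ε) ^ (1 - q / p) * (P + ε) ^ (q / p)))
      (nhdsWithin 0 (Set.Ioi 0)) (nhds ((1 + C) * (Y ^ (1 - q / p) * P ^ (q / p)))) :=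
    ENNReal.Tendsto.const_mul
      (ENNReal.Tendsto.mul hadd (Or.inr hP1) hadd (Or.inr hY1))
      (Or.inr (ENNReal.add_ne_top.2 ⟨ENNReal.one_ne_top, hC⟩))
  refine ge_of_tendsto hlim ?_
  filter_upwards [self_mem_nhdsWithin,
    nhdsWithin_le_nhds (Iio_mem_nhds (show (0 : ℝ≥0∞) < 1 by norm_num))] with ε h0 h1
  exact key ε (ne_of_gt h0) (ne_top_of_lt h1)

lemma iSup_indicator_rpow {c : DyadicCube d → ℝ≥0∞} {x : EuclideanSpace ℝ (Fin d)} {r : ℝ}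
    (hr : 0 < r) : (⨆ Q : DyadicCube d, Q.1.indicator (fun _ => c Q) x) ^ r =
      ⨆ Q : DyadicCube d, Q.1.indicator (fun _ => c Q ^ r) x := by
  have h := (ENNReal.orderIsoRpow r hr).map_iSup fun Q : DyadicCube d =>
    Q.1.indicator (fun _ => c Q) x
  simp only [ENNReal.orderIsoRpow_apply] at h
  rw [h]
  refine iSup_congr fun Q => ?_
  by_cases hx : x ∈ Q.1 <;> simp [hx, hr]

lemma lintegral_maximalOp_rpow_le {p q : ℝ} (hp : 1 < p) (hq : 0 < q) (hqp : q < p)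
    (σ ω : Measure (EuclideanSpace ℝ (Fin d))) [IsLocallyFiniteMeasure σ]
    [IsLocallyFiniteMeasure ω] (lam : DyadicCube d → ℝ≥0) {f : EuclideanSpace ℝ (Fin d) → ℝ}
    (hf : AEMeasurable (fun x => ‖f x‖ₑ) σ) (hP : ∫⁻ x, ‖f x‖ₑ ^ p ∂σ ≠ ∞)
    {S : ℝ≥0∞} (hS : S ≠ ∞)
    (hS' : ∫⁻ x, ⨆ Q : DyadicCube d, Q.1.indicator (fun _ => (lam Q : ℝ≥0∞) ^ q *
        ((∫⁻ y in Q.1, rhoSup lam Q y ^ q ∂ω) / σ Q.1) ^ (q / (p - q))) x ∂ω ≤ S) :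
    ∫⁻ x, maximalOp σ lam f x ^ q ∂ω ≤ (1 + 2 ^ (q / p) * (4 * maximalConst p)) *
      (S ^ (1 - q / p) * (∫⁻ x, ‖f x‖ₑ ^ p ∂σ) ^ (q / p)) := by
  have hp0 : 0 < p := by linarith
  have hC : 2 ^ (q / p) * (4 * maximalConst p) ≠ ∞ :=
    ENNReal.mul_ne_top (ENNReal.rpow_ne_top_of_nonneg (by positivity) (by norm_num))
      (ENNReal.mul_ne_top (by norm_num) (maximalConst_ne_top hp))
  have hM : ∀ x, maximalOp σ lam f x ^ q = ⨆ Q : DyadicCube d,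
      Q.1.indicator (fun _ => (lam Q * avg σ (fun x => ‖f x‖ₑ) Q) ^ q) x :=
    fun x => iSup_indicator_rpow hq
  simp_rw [hM]
  rw [lintegral_iSup_indicator_eq_iSup_finset]
  refine iSup_le fun F => ?_
  refine ENNReal.le_mul_rpow_mul_rpow_of_forall_dilation hq hqp hS hP hC fun t _ ht => ?_
  have htp : t ^ p ≠ ∞ := ENNReal.rpow_ne_top_of_nonneg hp0.le ht
  have hint : ∫⁻ x, (t * ‖f x‖ₑ) ^ p ∂σ = t ^ p * ∫⁻ x, ‖f x‖ₑ ^ p ∂σ := by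
    simp_rw [ENNReal.mul_rpow_of_nonneg _ _ hp0.le]
    exact lintegral_const_mul' _ _ htp
  have h := lintegral_supOn_mul_avg_rpow_le hp hq hqp σ ω lam F (hf.const_mul t)
    (by rw [hint]; exact ENNReal.mul_ne_top htp hP)
  rw [hint] at h
  refine le_trans (le_of_eq ?_) (h.trans (add_le_add_left hS' _))
  rw [← lintegral_const_mul _ measurable_supOn]
  refine lintegral_congr fun x => ?_
  rw [supOn_rpow hq, supOn_rpow hq, ← ENNReal.mul_rpow_of_nonneg _ _ hq.le]
  congr 1
  simp_rw [avg_const_mul ht, mul_left_comm _ t, supOn, ENNReal.mul_iSup]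
  refine iSup_congr fun Q => iSup_congr fun _ => ?_
  by_cases hx : x ∈ Q.1 <;> simp [hx]

theorem maximalOpNorm_le_sufficientQuantity {p q : ℝ} (hp : 1 < p) (hq : 0 < q) (hqp : q < p)
    (σ ω : Measure (EuclideanSpace ℝ (Fin d))) [IsLocallyFiniteMeasure σ]
    [IsLocallyFiniteMeasure ω] (lam : DyadicCube d → ℝ≥0) :
    maximalOpNorm p q σ ω lam ≤ (1 + 2 ^ (q / p) * (4 * maximalConst p)) ^ q⁻¹ *
      sufficientQuantity p q σ ω lam := by
  have hp0 : 0 < p := by linarith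
  have hpq : 0 < p - q := by linarith
  have hs : 0 < q / (p - q) := div_pos hq hpq
  set C := 1 + 2 ^ (q / p) * (4 * maximalConst p)
  set S := ∫⁻ x, ⨆ Q : DyadicCube d, Q.1.indicator (fun _ =>
      (ω Q.1 / σ Q.1) ^ (q / (p - q)) * (lam Q : ℝ≥0∞) ^ q *
        LambdaSup ω lam q Q ^ (q ^ 2 / (p - q))) x ∂ω with hS
  have hsuff : sufficientQuantity p q σ ω lam = S ^ ((p - q) / (p * q)) := rfl
  have hexp : 0 < (p - q) / (p * q) := by positivity
  rw [hsuff]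
  rcases eq_or_ne S ∞ with htop | htop
  · have hC : C ^ q⁻¹ ≠ 0 := by
      rw [Ne, ENNReal.rpow_eq_zero_iff_of_pos (by positivity)]
      exact (zero_lt_one.trans_le le_self_add).ne'
    rw [htop, ENNReal.top_rpow_of_pos hexp, ENNReal.mul_top hC]
    exact le_top
  refine sInf_le fun f hf => ?_
  have hfin : ∫⁻ x, ‖f x‖ₑ ^ p ∂σ ≠ ∞ := by
    have := lintegral_rpow_enorm_lt_top_of_eLpNorm_lt_top
      (by simpa using hp0) ENNReal.ofReal_ne_top hf.2
    rw [ENNReal.toReal_ofReal hp0.le] at this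
    exact this.ne
  rw [eLpNorm_eq_lintegral_rpow_enorm_toReal (by simpa using hq) ENNReal.ofReal_ne_top,
    eLpNorm_eq_lintegral_rpow_enorm_toReal (by simpa using hp0) ENNReal.ofReal_ne_top,
    ENNReal.toReal_ofReal hp0.le, ENNReal.toReal_ofReal hq.le]
  simp only [enorm_eq_self, one_div]
  rw [ENNReal.rpow_inv_le_iff hq]
  refine (lintegral_maximalOp_rpow_le hp hq hqp σ ω lam hf.1.aemeasurable.enorm hfin htop ?_).trans
    (le_of_eq ?_)
  · refine lintegral_mono fun x => iSup_mono fun Q => Set.indicator_le_indicator ?_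
    -- If `ω(Q) ≠ 0`, the factor `ω(Q)` cancels the normalisation in `Λ_q`, and the two integrands
    -- agree.
    rcases eq_or_ne (ω Q.1) 0 with h0 | h0
    · rw [setLIntegral_measure_zero _ _ h0, ENNReal.zero_div, ENNReal.zero_rpow_of_pos hs, mul_zero]
      exact zero_le
    · refine le_of_eq ?_
      have he : 1 / q * (q ^ 2 / (p - q)) = q / (p - q) := by field_simp
      rw [LambdaSup, ← ENNReal.rpow_mul, he, mul_right_comm,
        ← ENNReal.mul_rpow_of_nonneg _ _ hs.le, mul_comm]
      congr 2
      rw [div_eq_mul_inv (ω Q.1), mul_right_comm, ENNReal.mul_div_cancel h0 (Q.measure_ne_top ω),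
        div_eq_mul_inv]
  · rw [ENNReal.mul_rpow_of_nonneg _ _ hq.le, ENNReal.mul_rpow_of_nonneg _ _ hq.le,
      ENNReal.rpow_inv_rpow hq.ne', ← ENNReal.rpow_mul, ← ENNReal.rpow_mul, mul_assoc]
    congr 3
    · field_simp
    · field_simp

end Sufficient

/-! ### Necessity -/

section Necessary

variable {d : ℕ}

/-- The infimum is attained. When `f` has norm zero one cannot divide, but a finite infimum supplies
an admissible constant. -/
lemma eLpNorm_maximalOp_le {p q : ℝ} {σ ω : Measure (EuclideanSpace ℝ (Fin d))}
    {lam : DyadicCube d → ℝ≥0} (hA : maximalOpNorm p q σ ω lam ≠ ∞)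
    {f : EuclideanSpace ℝ (Fin d) → ℝ} (hf : MemLp f (ENNReal.ofReal p) σ) :
    eLpNorm (maximalOp σ lam f) (ENNReal.ofReal q) ω ≤
      maximalOpNorm p q σ ω lam * eLpNorm f (ENNReal.ofReal p) σ := by
  rcases eq_or_ne (eLpNorm f (ENNReal.ofReal p) σ) 0 with h0 | h0
  · obtain ⟨C, hC, -⟩ := sInf_lt_iff.1 (lt_top_iff_ne_top.2 hA)
    simpa [h0] using hC f hf
  · rw [← ENNReal.div_le_iff_le_mul (Or.inl h0) (Or.inl hf.2.ne)]
    exact le_sInf fun C hC =>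
      (ENNReal.div_le_iff_le_mul (Or.inl h0) (Or.inl hf.2.ne)).2 (hC f hf)

lemma ae_forall_cube_measure_ne_zero (ω : Measure (EuclideanSpace ℝ (Fin d))) :
    ∀ᵐ x ∂ω, ∀ Q : DyadicCube d, x ∈ Q.1 → ω Q.1 ≠ 0 := by
  refine ae_all_iff.2 fun Q => ?_
  by_cases h : ω Q.1 = 0
  · filter_upwards [measure_eq_zero_iff_ae_notMem.1 h] with x hx hx'
    exact absurd hx' hx
  · exact ae_of_all _ fun _ _ => h

lemma supOn_ne_top {F : Finset (DyadicCube d)} {c : DyadicCube d → ℝ≥0∞}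
    (hc : ∀ Q ∈ F, c Q ≠ ∞) (x : EuclideanSpace ℝ (Fin d)) : supOn F c x ≠ ∞ := by
  refine ne_top_of_le_ne_top (ENNReal.sum_ne_top.2 fun Q hQ => ?_) supOn_le_sum
  by_cases hx : x ∈ Q.1 <;> simp [hx, hc Q hQ]

/-- Testing the maximal inequality on `f = sup_{Q ∈ G} a_Q 1_Q`. -/
lemma lintegral_supOn_mul_LambdaSup_rpow_le {p q γ : ℝ} (hp : 1 < p) (hγ : 0 < γ) (hγq : γ < q)
    (σ ω : Measure (EuclideanSpace ℝ (Fin d))) [IsLocallyFiniteMeasure σ]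
    [IsLocallyFiniteMeasure ω] (lam : DyadicCube d → ℝ≥0)
    (hlam : ∀ Q : DyadicCube d, σ Q.1 = 0 → lam Q = 0 ∨ ω Q.1 = 0)
    (hA : maximalOpNorm p q σ ω lam ≠ ∞) (G : Finset (DyadicCube d))
    (a : DyadicCube d → ℝ≥0∞) (ha : ∀ Q ∈ G, a Q ≠ ∞) :
    ∫⁻ x, supOn G (fun Q => (a Q * LambdaSup ω lam γ Q) ^ q) x ∂ω ≤
      maximalConst (q / γ) * (maximalOpNorm p q σ ω lam ^ q *
        (∫⁻ x, supOn G (fun Q => a Q ^ p) x ∂σ) ^ (q / p)) := by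
  have hp0 : 0 < p := by linarith
  have hq : 0 < q := by linarith
  have hr : 1 < q / γ := (one_lt_div hγ).2 hγq
  set f : EuclideanSpace ℝ (Fin d) → ℝ := fun x => (supOn G a x).toReal with hf
  have hfe : ∀ x, ‖f x‖ₑ = supOn G a x := fun x => by
    rw [hf, Real.enorm_eq_ofReal ENNReal.toReal_nonneg, ENNReal.ofReal_toReal (supOn_ne_top ha x)]
  have hfp : eLpNorm f (ENNReal.ofReal p) σ =
      (∫⁻ x, supOn G (fun Q => a Q ^ p) x ∂σ) ^ p⁻¹ := by
    rw [eLpNorm_eq_lintegral_rpow_enorm_toReal (by simpa using hp0) ENNReal.ofReal_ne_top,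
      ENNReal.toReal_ofReal hp0.le, one_div]
    simp_rw [hfe, supOn_rpow hp0]
  have hfL : MemLp f (ENNReal.ofReal p) σ := by
    refine ⟨measurable_supOn.ennreal_toReal.aestronglyMeasurable, ?_⟩
    rw [hfp, lt_top_iff_ne_top]
    exact ENNReal.rpow_ne_top_of_nonneg (by positivity)
      (lintegral_supOn_ne_top σ fun Q hQ => ENNReal.rpow_ne_top_of_nonneg hp0.le (ha Q hQ))
  set h : EuclideanSpace ℝ (Fin d) → ℝ≥0∞ := fun x =>
    ⨆ Q ∈ G, Q.1.indicator (fun y => a Q * rhoSup lam Q y) x with hh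
  have hmeas : Measurable h := Measurable.iSup fun Q => Measurable.iSup fun _ =>
    ((measurable_rhoSup lam Q).const_mul _).indicator Q.measurableSet
  -- For `R ⊆ Q` one has `f ≥ a_Q` on `R`, so its average there is at least `a_Q` unless `σ(R) = 0`;
  -- `hlam` makes that exception harmless off an `ω`-null set.
  have hle : ∀ᵐ x ∂ω, h x ≤ maximalOp σ lam f x := by
    filter_upwards [ae_forall_cube_measure_ne_zero ω] with x hx
    refine iSup₂_le fun Q hQ => Set.indicator_apply_le' (fun hxQ => ?_) fun _ => zero_le
    simp only [rhoSup, ENNReal.mul_iSup]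
    refine iSup₂_le fun R hRQ => ?_
    by_cases hxR : x ∈ R.1
    · rw [Set.indicator_of_mem hxR]
      rcases eq_or_ne (lam R) 0 with h0 | h0
      · simp [h0]
      have hσ : σ R.1 ≠ 0 := fun hσ => (hlam R hσ).elim h0 (hx R hxR)
      refine le_trans ?_ (le_iSup _ R)
      rw [Set.indicator_of_mem hxR, mul_comm]
      refine mul_le_mul_right ?_ _
      exact le_avg hσ fun y hy => (le_supOn hQ (hRQ hy)).trans_eq (hfe y).symm
    · simp [hxR]
  have havg : ∀ Q ∈ G, (a Q * LambdaSup ω lam γ Q) ^ q ≤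
      avg ω (fun x => h x ^ γ) Q ^ (q / γ) := by
    intro Q hQ
    have h1 : a Q ^ γ * avg ω (fun x => rhoSup lam Q x ^ γ) Q ≤ avg ω (fun x => h x ^ γ) Q := by
      rw [← avg_const_mul (ENNReal.rpow_ne_top_of_nonneg hγ.le (ha Q hQ))]
      refine ENNReal.div_le_div_right
        (setLIntegral_mono_ae' Q.measurableSet (ae_of_all _ fun x hx => ?_)) _
      rw [← ENNReal.mul_rpow_of_nonneg _ _ hγ.le]
      refine ENNReal.rpow_le_rpow ?_ hγ.le
      refine le_trans ?_ (le_iSup₂ (f := fun (Q : DyadicCube d) (_ : Q ∈ G) =>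
        Q.1.indicator (fun y => a Q * rhoSup lam Q y) x) Q hQ)
      rw [Set.indicator_of_mem hx]
    have h2 : (a Q * LambdaSup ω lam γ Q) ^ q =
        (a Q ^ γ * avg ω (fun x => rhoSup lam Q x ^ γ) Q) ^ (q / γ) := by
      rw [LambdaSup, ENNReal.mul_rpow_of_nonneg _ _ hq.le,
        ENNReal.mul_rpow_of_nonneg _ _ (zero_lt_one.trans hr).le, ← ENNReal.rpow_mul,
        ← ENNReal.rpow_mul, mul_div_cancel₀ _ hγ.ne', one_div_mul_eq_div, avg]
    rw [h2]
    exact ENNReal.rpow_le_rpow h1 (zero_lt_one.trans hr).le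
  have hM := eLpNorm_maximalOp_le hA hfL
  rw [hfp, eLpNorm_eq_lintegral_rpow_enorm_toReal (by simpa using hq) ENNReal.ofReal_ne_top,
    ENNReal.toReal_ofReal hq.le, one_div, ENNReal.rpow_inv_le_iff hq,
    ENNReal.mul_rpow_of_nonneg _ _ hq.le, ← ENNReal.rpow_mul, inv_mul_eq_div] at hM
  simp only [enorm_eq_self] at hM
  calc ∫⁻ x, supOn G (fun Q => (a Q * LambdaSup ω lam γ Q) ^ q) x ∂ω
      ≤ ∫⁻ x, supOn G (avg ω (fun x => h x ^ γ)) x ^ (q / γ) ∂ω := by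
        refine lintegral_mono fun x => supOn_le fun Q hQ hx => (havg Q hQ).trans ?_
        exact ENNReal.rpow_le_rpow (le_supOn hQ hx) (zero_lt_one.trans hr).le
    _ ≤ maximalConst (q / γ) * ∫⁻ x, (h x ^ γ) ^ (q / γ) ∂ω :=
        lintegral_supOn_avg_rpow_le hr (hmeas.pow_const γ).aemeasurable G
    _ ≤ _ := by
        refine mul_le_mul_right (le_trans (lintegral_mono_ae ?_) hM) _
        filter_upwards [hle] with x hx
        rw [← ENNReal.rpow_mul, mul_div_cancel₀ _ hγ.ne']
        exact ENNReal.rpow_le_rpow hx hq.le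

lemma LambdaSup_eq_zero_of_measure_eq_zero {ω : Measure (EuclideanSpace ℝ (Fin d))}
    {lam : DyadicCube d → ℝ≥0} {γ : ℝ} (hγ : 0 < γ) {Q : DyadicCube d} (h : ω Q.1 = 0) :
    LambdaSup ω lam γ Q = 0 := by
  rw [LambdaSup, setLIntegral_measure_zero _ _ h, ENNReal.zero_div,
    ENNReal.zero_rpow_of_pos (by positivity)]

/-- Subcubes of a `σ`-null cube are `σ`-null. This neutralises the infinite ratio `ω(Q)/σ(Q)` and
keeps the test coefficients finite. -/
lemma LambdaSup_eq_zero_of_forall {σ ω : Measure (EuclideanSpace ℝ (Fin d))}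
    {lam : DyadicCube d → ℝ≥0} (hlam : ∀ Q : DyadicCube d, σ Q.1 = 0 → lam Q = 0 ∨ ω Q.1 = 0)
    {γ : ℝ} (hγ : 0 < γ) {Q : DyadicCube d} (h : σ Q.1 = 0) : LambdaSup ω lam γ Q = 0 := by
  have hzero : ∫⁻ x in Q.1, rhoSup lam Q x ^ γ ∂ω = 0 := by
    have hae : ∀ᵐ x ∂ω.restrict Q.1, rhoSup lam Q x ^ γ = 0 := by
      filter_upwards [ae_restrict_of_ae (ae_forall_cube_measure_ne_zero ω)] with x hx
      rw [ENNReal.rpow_eq_zero_iff_of_pos hγ, ← nonpos_iff_eq_zero]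
      refine iSup₂_le fun R hR => Set.indicator_apply_le' (fun hxR => ?_) fun _ => zero_le
      have := (hlam R (measure_mono_null hR h)).resolve_right (hx R hxR)
      simp [this]
    rw [lintegral_congr_ae hae, lintegral_zero]
  rw [LambdaSup, hzero, ENNReal.zero_div, ENNReal.zero_rpow_of_pos (by positivity)]

/-- Testing on the single function `1_Q` already bounds it. -/
lemma LambdaSup_ne_top {p q γ : ℝ} (hp : 1 < p) (hγ : 0 < γ) (hγq : γ < q)
    (σ ω : Measure (EuclideanSpace ℝ (Fin d))) [IsLocallyFiniteMeasure σ]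
    [IsLocallyFiniteMeasure ω] (lam : DyadicCube d → ℝ≥0)
    (hlam : ∀ Q : DyadicCube d, σ Q.1 = 0 → lam Q = 0 ∨ ω Q.1 = 0)
    (hA : maximalOpNorm p q σ ω lam ≠ ∞) (Q : DyadicCube d) : LambdaSup ω lam γ Q ≠ ∞ := by
  have hp0 : 0 < p := by linarith
  have hq : 0 < q := by linarith
  intro htop
  have hω : ω Q.1 ≠ 0 := fun h0 => by
    rw [LambdaSup_eq_zero_of_measure_eq_zero hγ h0] at htop
    exact ENNReal.zero_ne_top htop
  have h := lintegral_supOn_mul_LambdaSup_rpow_le hp hγ hγq σ ω lam hlam hA {Q} 1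
    (fun _ _ => ENNReal.one_ne_top)
  have hlow : ∞ ≤ ∫⁻ x, supOn {Q} (fun R => ((1 : DyadicCube d → ℝ≥0∞) R *
      LambdaSup ω lam γ R) ^ q) x ∂ω := by
    calc ∞ = ∫⁻ x, Q.1.indicator (fun _ => ∞) x ∂ω := by
          rw [lintegral_indicator_const Q.measurableSet, ENNReal.top_mul hω]
      _ ≤ _ := lintegral_mono fun x => Set.indicator_apply_le' (fun hx => by
          refine le_trans (le_of_eq ?_) (le_supOn (Finset.mem_singleton_self Q) hx)
          rw [htop, Pi.one_apply, one_mul, ENNReal.top_rpow_of_pos hq]) fun _ => zero_le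
  refine (ne_top_of_le_ne_top ?_ h) (top_le_iff.1 hlow)
  refine ENNReal.mul_ne_top (maximalConst_ne_top ((one_lt_div hγ).2 hγq)) (ENNReal.mul_ne_top
    (ENNReal.rpow_ne_top_of_nonneg hq.le hA) (ENNReal.rpow_ne_top_of_nonneg (by positivity)
    (lintegral_supOn_ne_top σ fun R _ => ?_)))
  simp

theorem necessaryQuantity_le_of_pos {p q γ : ℝ} (hp : 1 < p) (hqp : q < p) (hγ : 0 < γ)
    (hγq : γ < q) (σ ω : Measure (EuclideanSpace ℝ (Fin d))) [IsLocallyFiniteMeasure σ]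
    [IsLocallyFiniteMeasure ω] (lam : DyadicCube d → ℝ≥0)
    (hlam : ∀ Q : DyadicCube d, σ Q.1 = 0 → lam Q = 0 ∨ ω Q.1 = 0) :
    necessaryQuantity p q γ σ ω lam ≤ (2 * maximalConst (q / γ) * 4 ^ (q / p)) ^ q⁻¹ *
      maximalOpNorm p q σ ω lam := by
  have hp0 : 0 < p := by linarith
  have hq : 0 < q := by linarith
  have hpq : 0 < p - q := by linarith
  have hs : 0 < q / (p - q) := div_pos hq hpq
  set A := maximalOpNorm p q σ ω lam with hAdef
  set C := 2 * maximalConst (q / γ) * 4 ^ (q / p) with hC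
  rcases eq_or_ne A ∞ with hA | hA
  · have hC0 : C ^ q⁻¹ ≠ 0 := by
      rw [Ne, ENNReal.rpow_eq_zero_iff_of_pos (by positivity)]
      refine mul_ne_zero (mul_ne_zero two_ne_zero
        (maximalConst_ne_zero ((one_lt_div hγ).2 hγq))) ?_
      exact (ENNReal.rpow_pos (by norm_num) (by norm_num)).ne'
    rw [hA, ENNReal.mul_top hC0]
    exact le_top
  set Λ : DyadicCube d → ℝ≥0∞ := LambdaSup ω lam γ with hΛ
  have hΛtop : ∀ Q, Λ Q ≠ ∞ := LambdaSup_ne_top hp hγ hγq σ ω lam hlam hA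
  have hfin : ∀ (u v : ℝ), 0 < u → 0 < v → ∀ Q : DyadicCube d,
      (ω Q.1 / σ Q.1) ^ u * Λ Q ^ v ≠ ∞ := by
    intro u v hu hv Q
    rcases eq_or_ne (σ Q.1) 0 with h0 | h0
    · rw [hΛ, LambdaSup_eq_zero_of_forall hlam hγ h0, ENNReal.zero_rpow_of_pos hv, mul_zero]
      exact ENNReal.zero_ne_top
    · exact ENNReal.mul_ne_top (ENNReal.rpow_ne_top_of_nonneg hu.le
        (ENNReal.div_ne_top (Q.measure_ne_top ω) h0)) (ENNReal.rpow_ne_top_of_nonneg hv.le (hΛtop Q))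
  set c : DyadicCube d → ℝ≥0∞ := fun Q =>
    (ω Q.1 / σ Q.1) ^ (q / (p - q)) * Λ Q ^ (p * q / (p - q)) with hc
  have hctop : ∀ Q, c Q ≠ ∞ := hfin _ _ hs (by positivity)
  -- The exponents solve `(a Λ)^q = c` and `a^p σ(Q) = c ω(Q)`; the latter is only `≤` when `σ(Q) =
  -- 0`.
  set a : DyadicCube d → ℝ≥0∞ := fun Q =>
    (ω Q.1 / σ Q.1) ^ (1 / (p - q)) * Λ Q ^ (q / (p - q)) with ha
  have hatop : ∀ Q, a Q ≠ ∞ := hfin _ _ (by positivity) hs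
  have hac : ∀ Q, (a Q * Λ Q) ^ q = c Q := by
    intro Q
    have h1 : Λ Q ^ (q / (p - q)) * Λ Q = Λ Q ^ (p / (p - q)) := by
      have he : p / (p - q) = q / (p - q) + 1 := by field_simp; ring
      rw [he, ENNReal.rpow_add_of_nonneg _ _ hs.le zero_le_one, ENNReal.rpow_one]
    simp only [ha, hc]
    rw [mul_assoc, h1, ENNReal.mul_rpow_of_nonneg _ _ hq.le, ← ENNReal.rpow_mul,
      ← ENNReal.rpow_mul]
    congr 2 <;> ring
  have haσ : ∀ Q : DyadicCube d, a Q ^ p * σ Q.1 ≤ c Q * ω Q.1 := by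
    intro Q
    have h1 : a Q ^ p = c Q * (ω Q.1 / σ Q.1) := by
      simp only [ha, hc]
      rw [ENNReal.mul_rpow_of_nonneg _ _ hp0.le, ← ENNReal.rpow_mul, ← ENNReal.rpow_mul,
        mul_right_comm]
      have he : 1 / (p - q) * p = q / (p - q) + 1 := by field_simp; ring
      rw [he, ENNReal.rpow_add_of_nonneg _ _ hs.le zero_le_one, ENNReal.rpow_one]
      congr 2; ring
    rw [h1, mul_assoc, mul_comm (ω Q.1 / σ Q.1)]
    exact mul_le_mul_right ENNReal.mul_div_le _
  have hF : ∀ F : Finset (DyadicCube d), ∫⁻ x, supOn F c x ∂ω ≤ (C * A ^ q) ^ (1 - q / p)⁻¹ := by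
    intro F
    refine ENNReal.le_rpow_of_le_mul_rpow ((div_lt_one hp0).2 hqp)
      (lintegral_supOn_ne_top ω fun Q _ => hctop Q) ?_
    obtain ⟨G, -, hdom, hsum⟩ := exists_sparse_subfamily F c fun Q _ => hctop Q
    have hpt : ∀ x, supOn F c x ≤ 2 * supOn G c x := fun x => supOn_le fun Q hQ hx => by
      rcases eq_or_ne (c Q) 0 with h0 | h0
      · simp [h0]
      obtain ⟨R, hR, hQR, hle⟩ := hdom Q hQ h0
      exact hle.trans (mul_le_mul_right (le_supOn hR (hQR hx)) _)
    have htest := lintegral_supOn_mul_LambdaSup_rpow_le hp hγ hγq σ ω lam hlam hA G a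
      fun Q _ => hatop Q
    have hac' : (fun Q => (a Q * LambdaSup ω lam γ Q) ^ q) = c := funext hac
    rw [hac'] at htest
    -- The two measures are comparable only cube by cube, so the passage from `σ` to `ω` goes
    -- through sums; sparsity then restores the supremum.
    have hσ : ∫⁻ x, supOn G (fun Q => a Q ^ p) x ∂σ ≤ 4 * ∫⁻ x, supOn F c x ∂ω := by
      calc ∫⁻ x, supOn G (fun Q => a Q ^ p) x ∂σ
          ≤ ∑ Q ∈ G, a Q ^ p * σ Q.1 := lintegral_supOn_le_sum σ
        _ ≤ ∑ Q ∈ G, c Q * ω Q.1 := Finset.sum_le_sum fun Q _ => haσ Q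
        _ = ∫⁻ x, ∑ Q ∈ G, Q.1.indicator (fun _ => c Q) x ∂ω := (lintegral_sum_indicator ω).symm
        _ ≤ ∫⁻ x, 4 * supOn F c x ∂ω := lintegral_mono hsum
        _ = _ := lintegral_const_mul _ measurable_supOn
    have hθ : 0 ≤ q / p := by positivity
    calc ∫⁻ x, supOn F c x ∂ω ≤ ∫⁻ x, 2 * supOn G c x ∂ω := lintegral_mono hpt
      _ = 2 * ∫⁻ x, supOn G c x ∂ω := lintegral_const_mul _ measurable_supOn
      _ ≤ 2 * (maximalConst (q / γ) * (A ^ q * (4 * ∫⁻ x, supOn F c x ∂ω) ^ (q / p))) := by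
        refine mul_le_mul_right (htest.trans ?_) _
        gcongr
      _ = _ := by
        rw [ENNReal.mul_rpow_of_nonneg _ _ hθ, hC]
        ring
  have hX : necessaryQuantity p q γ σ ω lam =
      (⨆ F : Finset (DyadicCube d), ∫⁻ x, supOn F c x ∂ω) ^ ((p - q) / (p * q)) := by
    rw [← lintegral_iSup_indicator_eq_iSup_finset, necessaryQuantity]
  rw [hX]
  refine (ENNReal.rpow_le_rpow (iSup_le hF) (by positivity)).trans (le_of_eq ?_)
  have he : (1 - q / p)⁻¹ * ((p - q) / (p * q)) = q⁻¹ := by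
    have : 1 - q / p = (p - q) / p := by field_simp
    rw [this, inv_div]
    field_simp
  rw [← ENNReal.rpow_mul, he, ENNReal.mul_rpow_of_nonneg _ _ (by positivity),
    ENNReal.rpow_rpow_inv hq.ne']

/-- Monotonicity of power means, comparing a negative with a positive exponent. -/
lemma LambdaSup_le_of_neg_of_pos {ω : Measure (EuclideanSpace ℝ (Fin d))}
    [IsLocallyFiniteMeasure ω] {lam : DyadicCube d → ℝ≥0} {γ δ : ℝ} (hγ : γ < 0) (hδ : 0 < δ)
    {Q : DyadicCube d} (hQ : ω Q.1 ≠ 0) : LambdaSup ω lam γ Q ≤ LambdaSup ω lam δ Q := by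
  have hQt := Q.measure_ne_top ω
  rw [LambdaSup, LambdaSup]
  have hm := measurable_rhoSup lam Q
  set u := rhoSup lam Q
  set U := ∫⁻ x in Q.1, u x ^ γ ∂ω with hU
  set V := ∫⁻ x in Q.1, u x ^ δ ∂ω with hV
  have hγ' : 1 / γ < 0 := one_div_neg.2 hγ
  rcases eq_or_ne V ∞ with hVt | hVt
  · rw [hVt, ENNReal.top_div_of_ne_top hQt, ENNReal.top_rpow_of_pos (by positivity)]
    exact le_top
  rcases eq_or_ne U ∞ with hUt | hUt
  · rw [hUt, ENNReal.top_div_of_ne_top hQt, ENNReal.top_rpow_of_neg hγ']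
    exact zero_le
  have hδγ : 0 < δ - γ := by linarith
  -- Hölder weights with `α + β = 1` and `γ α + δ β = 0`, so that the product of the powers of `u`
  -- is `1`.
  set α := δ / (δ - γ) with hα
  set β := -γ / (δ - γ) with hβ
  have hα0 : 0 < α := by positivity
  have hβ0 : 0 < β := div_pos (by linarith) hδγ
  have hαβ : α + β = 1 := by rw [hα, hβ]; field_simp; ring
  have hmean : ω Q.1 ≤ U ^ α * V ^ β := by
    calc ω Q.1 = ∫⁻ _ in Q.1, 1 ∂ω := by simp
      _ = ∫⁻ x in Q.1, (u x ^ γ) ^ α * (u x ^ δ) ^ β ∂ω := by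
        refine lintegral_congr_ae ?_
        filter_upwards [ae_lt_top (hm.pow_const γ) hUt, ae_lt_top (hm.pow_const δ) hVt]
          with x hx1 hx2
        have h0 : u x ≠ 0 := fun h => by
          rw [h, ENNReal.zero_rpow_of_neg hγ] at hx1
          exact lt_irrefl _ hx1
        have ht : u x ≠ ∞ := fun h => by
          rw [h, ENNReal.top_rpow_of_pos hδ] at hx2
          exact lt_irrefl _ hx2
        rw [← ENNReal.rpow_mul, ← ENNReal.rpow_mul, ← ENNReal.rpow_add _ _ h0 ht]
        have : γ * α + δ * β = 0 := by rw [hα, hβ]; field_simp; ring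
        rw [this, ENNReal.rpow_zero]
      _ ≤ U ^ α * V ^ β := ENNReal.lintegral_mul_norm_pow_le (hm.pow_const γ).aemeasurable
        (hm.pow_const δ).aemeasurable hα0.le hβ0.le hαβ
  have hone : 1 ≤ (U / ω Q.1) ^ α * (V / ω Q.1) ^ β := by
    rw [ENNReal.div_rpow_of_nonneg _ _ hα0.le, ENNReal.div_rpow_of_nonneg _ _ hβ0.le,
      ENNReal.mul_div_mul_comm (Or.inr (ENNReal.rpow_ne_top_of_nonneg hβ0.le hQt))
        (Or.inr (ENNReal.rpow_pos (pos_iff_ne_zero.2 hQ) hQt).ne') |>.symm,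
      ← ENNReal.rpow_add _ _ hQ hQt, hαβ, ENNReal.rpow_one,
      ENNReal.le_div_iff_mul_le (Or.inl hQ) (Or.inl hQt), one_mul]
    exact hmean
  have hinv : ((U / ω Q.1) ^ α)⁻¹ ≤ (V / ω Q.1) ^ β := by
    rw [ENNReal.inv_le_iff_le_mul]
    · exact hone
    · intro h
      exact absurd h (ENNReal.rpow_ne_top_of_nonneg hβ0.le (ENNReal.div_ne_top hVt hQ))
    · intro h
      exact absurd h (ENNReal.rpow_ne_top_of_nonneg hα0.le (ENNReal.div_ne_top hUt hQ))
  have hκ : 0 < 1 / (β * δ) := by positivity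
  have hfinal := ENNReal.rpow_le_rpow hinv hκ.le
  rw [← ENNReal.rpow_neg, ← ENNReal.rpow_mul, ← ENNReal.rpow_mul] at hfinal
  have e1 : -α * (1 / (β * δ)) = 1 / γ := by
    have := hγ.ne
    rw [hα, hβ]; field_simp
  have e2 : β * (1 / (β * δ)) = 1 / δ := by field_simp
  rwa [e1, e2] at hfinal

lemma necessaryQuantity_le_of_neg_of_pos {p q γ δ : ℝ} (hq : 0 < q) (hqp : q < p) (hγ : γ < 0)
    (hδ : 0 < δ) (σ ω : Measure (EuclideanSpace ℝ (Fin d))) [IsLocallyFiniteMeasure ω]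
    (lam : DyadicCube d → ℝ≥0) :
    necessaryQuantity p q γ σ ω lam ≤ necessaryQuantity p q δ σ ω lam := by
  have hpq : 0 < p - q := by linarith
  have hp : 0 < p := by linarith
  refine ENNReal.rpow_le_rpow (lintegral_mono fun x => iSup_mono fun Q =>
    Set.indicator_le_indicator ?_) (by positivity)
  rcases eq_or_ne (ω Q.1) 0 with h0 | h0
  · rw [h0, ENNReal.zero_div, ENNReal.zero_rpow_of_pos (by positivity), zero_mul]
    exact zero_le
  · gcongr
    exact LambdaSup_le_of_neg_of_pos hγ hδ h0

end Necessary

theorem proposition2p1 (p q : ℝ) (hp : 1 < p) (hq : 0 < q) (hqp : q < p) :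
    (∃ C : ℝ≥0, ∀ (d : ℕ) (σ ω : Measure (EuclideanSpace ℝ (Fin d)))
        [IsLocallyFiniteMeasure σ] [IsLocallyFiniteMeasure ω] (lam : DyadicCube d → ℝ≥0),
        maximalOpNorm p q σ ω lam ≤ C * sufficientQuantity p q σ ω lam) ∧
    (∀ γ : ℝ, γ < q → γ ≠ 0 →
      ∃ C : ℝ≥0, ∀ (d : ℕ) (σ ω : Measure (EuclideanSpace ℝ (Fin d)))
        [IsLocallyFiniteMeasure σ] [IsLocallyFiniteMeasure ω] (lam : DyadicCube d → ℝ≥0),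
        (∀ Q : DyadicCube d, σ Q.1 = 0 → lam Q = 0 ∨ ω Q.1 = 0) →
          necessaryQuantity p q γ σ ω lam ≤ C * maximalOpNorm p q σ ω lam) := by
  have hp0 : 0 < p := by linarith
  have hpos : ∀ γ : ℝ, γ < q → 0 < γ →
      ∃ C : ℝ≥0, ∀ (d : ℕ) (σ ω : Measure (EuclideanSpace ℝ (Fin d)))
        [IsLocallyFiniteMeasure σ] [IsLocallyFiniteMeasure ω] (lam : DyadicCube d → ℝ≥0),
        (∀ Q : DyadicCube d, σ Q.1 = 0 → lam Q = 0 ∨ ω Q.1 = 0) →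
          necessaryQuantity p q γ σ ω lam ≤ C * maximalOpNorm p q σ ω lam := by
    intro γ hγq hγ
    have hC : (2 * maximalConst (q / γ) * 4 ^ (q / p)) ^ q⁻¹ ≠ ∞ :=
      ENNReal.rpow_ne_top_of_nonneg (by positivity) (ENNReal.mul_ne_top
        (ENNReal.mul_ne_top (by norm_num) (maximalConst_ne_top ((one_lt_div hγ).2 hγq)))
        (ENNReal.rpow_ne_top_of_nonneg (by positivity) (by norm_num)))
    refine ⟨((2 * maximalConst (q / γ) * 4 ^ (q / p)) ^ q⁻¹).toNNReal, fun d σ ω _ _ lam hlam => ?_⟩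
    rw [ENNReal.coe_toNNReal hC]
    exact necessaryQuantity_le_of_pos hp hqp hγ hγq σ ω lam hlam
  refine ⟨?_, fun γ hγq hγ0 => ?_⟩
  · have hC : (1 + 2 ^ (q / p) * (4 * maximalConst p)) ^ q⁻¹ ≠ ∞ :=
      ENNReal.rpow_ne_top_of_nonneg (by positivity) (ENNReal.add_ne_top.2 ⟨ENNReal.one_ne_top,
        ENNReal.mul_ne_top (ENNReal.rpow_ne_top_of_nonneg (by positivity) (by norm_num))
          (ENNReal.mul_ne_top (by norm_num) (maximalConst_ne_top hp))⟩)
    refine ⟨((1 + 2 ^ (q / p) * (4 * maximalConst p)) ^ q⁻¹).toNNReal, fun d σ ω _ _ lam => ?_⟩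
    rw [ENNReal.coe_toNNReal hC]
    exact maximalOpNorm_le_sufficientQuantity hp hq hqp σ ω lam
  · rcases lt_or_gt_of_ne hγ0 with hneg | hpos'
    -- Any positive exponent below `q` would do.
    · obtain ⟨C, hC⟩ := hpos (q / 2) (by linarith) (by linarith)
      exact ⟨C, fun d σ ω _ _ lam hlam => (necessaryQuantity_le_of_neg_of_pos hq hqp hneg
        (by linarith) σ ω lam).trans (hC d σ ω lam hlam)⟩
    · exact hpos γ hγq hpos'
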